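/- Throughout, $\log$ is the base $2$ logarithm. A (perfect) secret sharing scheme for a finite set $V$ of participants consists of random variables on a common probability space, with finitely many values: a secret $\xi$ of positive Shannon entropy and a share $\xi_v$ for each $v\in V$. It realizes an access structure $\Gamma$ (a collection of subsets of $V$, called authorized) if for every $A\in\Gamma$ the shares $(\xi_v)_{v\in A}$ determine $\xi$ with probability one, and for every $A\subseteq V$ with $A\notin\Gamma$ the collection $(\xi_v)_{v\in A}$ is independent of $\xi$. The information ratio of $\Gamma$ is the infimum, over all schemes realizing $\Gamma$, of $\max_{v\in V} \mathbf H(\xi_v)/\mathbf H(\xi)$, where $\mathbf H$ is Shannon entropy. For a simple graph $G$, or a $d$-uniform hypergraph $\mathcal H$ (every hyperedge is a $d$-element set of vertices), the participants are the vertices, a set is authorized if and only if it contains an edge (a hyperedge), and $\sigma(G)$, $\sigma(\mathcal H)$ denotes the information ratio of this access structure. Then: 1. For every graph $G$ on $n$ vertices, $\displaystyle\sigma(G)\le\Big(\frac12+o(1)\Big)\frac{n}{\log n}$. 2. If every vertex of the graph $G$ on $n$ vertices has degree at least $n-m$, then $\displaystyle\sigma(G)\le(0.722+o(1))\frac{m}{\log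 m}$. 3. Let $d\ge 2$. For every $d$-uniform hypergraph $\mathcal H$ on $n$ vertices, $\displaystyle\sigma(\mathcal H)\le\Big(\frac1{d!}+o(1)\Big)\frac{n^{d-1}}{\log n}$. 4. Let $d\ge2$. If $\mathcal H$ is a $d$-uniform hypergraph on $n$ vertices such that every set of $d-1$ vertices that is contained in a hyperedge is contained in at least $n-m$ hyperedges, then $\displaystyle\sigma(\mathcal H)\le\Big(\frac{1.443}{d!}+o(1)\Big)\frac{n^{d-2}m}{\log m}$. Here $d$ is fixed, and $o(1)$ denotes a quantity that tends to $0$, uniformly over all graphs or hypergraphs in question, as $n\to\infty$ (in 1 and 3), respectively as both $n\to\infty$ and $m\to\infty$ (in 2 and 4). That is, for every $\varepsilon>0$ (and $d$) there is an $N$ such that the inequality holds with $\varepsilon$ in place of $o(1)$ for all $n\ge N$ (in 1 and 3), respectively for all integers $n,m\ge N$ (in 2 and 4). -/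

import Mathlib

open scoped ENNReal Nat

universe u

noncomputable section

/-- The Shannon entropy, in bits, of a probability distribution on a finite set. -/
def shannonEntropy {α : Type*} [Fintype α] (q : PMF α) : ℝ :=
  (∑ a, Real.negMulLog (q a).toReal) / Real.log 2

/-- A secret sharing scheme for the participants `V`: a secret and one share for every
participant, which are random variables on a common probability space with values in finite
sets. The secret is not almost surely constant. -/
structure SecretSharingScheme (V : Type u) where
  /-- the sample space -/
  Ω : Type
  /-- the probability distribution on the sample space -/
  P : PMF Ω
  /-- the set of possible secrets -/
  Secret : Type
  [fintypeSecret : Fintype Secret]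
  /-- the set of possible shares of a participant -/
  Share : V → Type
  [fintypeShare : ∀ v, Fintype (Share v)]
  /-- the secret, as a random variable -/
  secret : Ω → Secret
  /-- the share of a participant, as a random variable -/
  share : ∀ v, Ω → Share v
  entropy_secret_pos : 0 < shannonEntropy (P.map secret)

attribute [instance] SecretSharingScheme.fintypeSecret SecretSharingScheme.fintypeShare

namespace SecretSharingScheme

variable {V : Type u} (𝒮 : SecretSharingScheme V)

/-- The collection of the shares of the participants in `A`. -/
def shares (A : Set V) (ω : 𝒮.Ω) : ∀ v : A, 𝒮.Share v := fun v => 𝒮.share v ω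

/-- The participants in `A` can reconstruct the secret from their shares (with probability one). -/
def Recovers (A : Set V) : Prop :=
  ∃ dec : (∀ v : A, 𝒮.Share v) → 𝒮.Secret,
    ∀ ω ∈ 𝒮.P.support, dec (𝒮.shares A ω) = 𝒮.secret ω

/-- The collection of the shares of the participants in `A` is independent of the secret. -/
def LearnsNothing (A : Set V) : Prop :=
  ∀ (s : 𝒮.Secret) (a : ∀ v : A, 𝒮.Share v),
    𝒮.P.map (fun ω => (𝒮.secret ω, 𝒮.shares A ω)) (s, a)
      = 𝒮.P.map 𝒮.secret s * 𝒮.P.map (𝒮.shares A) a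

/-- The scheme is a perfect scheme realizing the access structure `Γ`
(the collection of the authorized sets). -/
def Realizes (Γ : Set (Set V)) : Prop :=
  (∀ A ∈ Γ, 𝒮.Recovers A) ∧ (∀ A ∉ Γ, 𝒮.LearnsNothing A)

/-- The ratio between the size of the largest share and the size of the secret,
where sizes are entropies. -/
def ratio : ℝ≥0∞ :=
  ⨆ v : V, ENNReal.ofReal
    (shannonEntropy (𝒮.P.map (𝒮.share v)) / shannonEntropy (𝒮.P.map 𝒮.secret))

end SecretSharingScheme

/-- The information ratio (complexity) of an access structure: the infimum of the ratios of all
the perfect schemes realizing it (`∞` if there are none). -/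
def informationRatio {V : Type u} (Γ : Set (Set V)) : ℝ≥0∞ :=
  ⨅ (𝒮 : SecretSharingScheme V) (_ : 𝒮.Realizes Γ), 𝒮.ratio

/-- The access structure based on a graph: a set of vertices is authorized if and only if it
contains both endpoints of some edge. -/
def SimpleGraph.accessStructure {V : Type u} (G : SimpleGraph V) : Set (Set V) :=
  {A | ∃ v ∈ A, ∃ w ∈ A, G.Adj v w}

/-- The access structure based on a hypergraph: a set of vertices is authorized if and only if it
contains some hyperedge. -/
def Hypergraph.accessStructure {V : Type u} (H : Hypergraph V) : Set (Set V) :=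
  {A | ∃ e ∈ H.edgeSet, e ⊆ A}

/-- `H` is a `d`-uniform hypergraph whose vertex set is the whole type `V`. -/
def Hypergraph.IsUniformOn {V : Type u} (H : Hypergraph V) (d : ℕ) : Prop :=
  H.vertexSet = Set.univ ∧ ∀ e ∈ H.edgeSet, e.ncard = d

/-- The number of hyperedges that contain the set `T`. -/
def Hypergraph.setDegree {V : Type u} (H : Hypergraph V) (T : Set V) : ℕ :=
  {e ∈ H.edgeSet | T ⊆ e}.ncard

end

noncomputable section

/-! ### Entropy of finite distributions -/

section Entropy

/-! Put `t = d - 2`. For a tuple `f` of `t` vertices, the link graph of `f` consists of the pairs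
that complete `f` to a hyperedge. A biclique of the link graph, together with the `t` singletons of
`f`, is a complete `d`-partite piece of the hypergraph.

Suppose that in every link graph a family of bicliques indexed by `I` covers each edge at least `μ`
times and each vertex lies in at most `ℓ` of them. Taken over all `n ^ t` tuples, every hyperedge is
a transversal of at least `M = μ (t + 2)! / 2` pieces. The secret consists of `M` field elements,
Reed-Solomon encoded with one symbol per piece, and each symbol is shared additively among the parts
of its piece. A hyperedge recovers `M` symbols, hence the secret; an independent set misses a part
of every piece and learns nothing. The ratio is the number of pieces through a vertex divided by
`M`, which is at most `n ^ t / (t + 2)! * (2 / μ) * (ℓ + t |I| / n)`.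

Two covers give the bounds. In general, `chunkCover` splits the vertices into chunks of about `log
n` vertices and groups the outside vertices by their trace on a chunk; then `μ = 2` and `ℓ` is about
`n / log n`. In the dense case, `zeroSetCover` averages over random sets of density `1 / (s + 1)`,
with `s` about `m / ln m`. The constant `1 / ln 2 = 1.4427` comes from the change to base 2. Graphs
are the case `t = 0`. -/

theorem shannonEntropy_le_log_card {α : Type*} [Fintype α] (q : PMF α) :
    shannonEntropy q ≤ Real.log (Fintype.card α) / Real.log 2 := by
  have hsum : ∑ a, (q a).toReal = 1 := by
    rw [← ENNReal.toReal_sum fun a _ => q.apply_ne_top a, ← tsum_fintype (L := .unconditional _),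
      q.tsum_coe, ENNReal.toReal_one]
  have hne : Nonempty α := by
    by_contra h
    rw [not_nonempty_iff] at h
    simp at hsum
  have hpos : (0 : ℝ) < Fintype.card α := by exact_mod_cast Fintype.card_pos
  refine div_le_div_of_nonneg_right ?_ (Real.log_nonneg one_le_two)
  have hj := Real.concaveOn_negMulLog.le_map_sum (t := Finset.univ)
    (w := fun _ : α => (Fintype.card α : ℝ)⁻¹) (p := fun a => (q a).toReal)
    (fun _ _ => by positivity) (by simp [hpos.ne']) (fun a _ => ENNReal.toReal_nonneg)
  simp only [smul_eq_mul, ← Finset.mul_sum, hsum, mul_one] at hj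
  rw [Real.negMulLog, Real.log_inv, neg_mul_neg] at hj
  exact le_of_mul_le_mul_left hj (by positivity)

theorem shannonEntropy_eq_log_card {α : Type*} [Fintype α] [Nonempty α] (q : PMF α)
    (hq : ∀ a, q a = (Fintype.card α : ℝ≥0∞)⁻¹) :
    shannonEntropy q = Real.log (Fintype.card α) / Real.log 2 := by
  have hpos : (Fintype.card α : ℝ) ≠ 0 := by exact_mod_cast Fintype.card_ne_zero
  simp only [shannonEntropy, hq, ENNReal.toReal_inv, ENNReal.toReal_natCast, Finset.sum_const,
    Finset.card_univ, nsmul_eq_mul, Real.negMulLog, Real.log_inv]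
  field_simp

open Classical in
theorem PMF.map_uniformOfFintype_apply {Ω β : Type*} [Fintype Ω] [Nonempty Ω] (g : Ω → β)
    (b : β) : (PMF.uniformOfFintype Ω).map g b
      = ((Finset.univ.filter fun ω => g ω = b).card : ℝ≥0∞) / Fintype.card Ω := by
  rw [PMF.map_apply, tsum_fintype, div_eq_mul_inv, ← nsmul_eq_mul, ← Finset.sum_const,
    Finset.sum_filter]
  refine Finset.sum_congr rfl fun ω _ => ?_
  by_cases h : g ω = b
  · simp [h]
  · simp [h, Ne.symm h]

end Entropy

/-! ### Linear schemes and multipartite decompositions -/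

section LinearScheme

open Classical in
-- Translation by a suitable `ω₀` preserves `g` and carries one fibre of `σ` to any other, so `σ` is
-- equidistributed on each fibre of `g`. A constant `g` gives uniformity of the secret, and the
-- shares of an unauthorized set give independence.
theorem card_fiber_eq_card_mul_card_fiber {Ω S β : Type*} [AddCommGroup Ω] [Fintype Ω]
    [AddCommGroup S] [Fintype S] (σ : Ω →+ S) (g : Ω → β)
    (h : ∀ s, ∃ ω₀, σ ω₀ = s ∧ ∀ ω, g (ω + ω₀) = g ω) (s : S) (b : β) :
    (Finset.univ.filter fun ω => g ω = b).card
      = Fintype.card S * (Finset.univ.filter fun ω => σ ω = s ∧ g ω = b).card := by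
  rw [Finset.card_eq_sum_card_fiberwise (f := σ) (t := Finset.univ) (fun _ _ => by simp),
    ← smul_eq_mul, Fintype.card, ← Finset.sum_const]
  refine Finset.sum_congr rfl fun s' _ => ?_
  obtain ⟨ω₀, hω₀, hg⟩ := h (s - s')
  refine Finset.card_bij (fun ω _ => ω + ω₀) ?_ (fun _ _ _ _ h => by simpa using h) ?_
  · intro ω hω
    simp only [Finset.mem_filter, Finset.mem_univ, true_and] at hω ⊢
    rw [map_add, hω₀, hω.2, hg]
    exact ⟨by abel, hω.1⟩
  · intro ω hω
    simp only [Finset.mem_filter, Finset.mem_univ, true_and] at hω ⊢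
    refine ⟨ω - ω₀, ⟨?_, ?_⟩, by abel⟩
    · rw [← hg, sub_add_cancel, hω.2]
    · rw [map_sub, hω₀, hω.1]
      abel

/-- A linear scheme: the secret and the shares are homomorphic images of a uniformly random
element of a finite abelian group. -/
theorem informationRatio_le_of_addMonoidHom {V : Type u} {Γ : Set (Set V)} {Ω S : Type}
    [AddCommGroup Ω] [Fintype Ω] [AddCommGroup S] [Fintype S] [Nontrivial S] (X : V → Type)
    [∀ v, AddCommGroup (X v)] [∀ v, Fintype (X v)] (σ : Ω →+ S) (sh : ∀ v, Ω →+ X v)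
    (hσ : Function.Surjective σ)
    (hrec : ∀ A ∈ Γ, ∀ ω, (∀ v ∈ A, sh v ω = 0) → σ ω = 0)
    (hpriv : ∀ A ∉ Γ, ∀ s, ∃ ω, σ ω = s ∧ ∀ v ∈ A, sh v ω = 0)
    (c : ℝ) (hc : ∀ v, Real.log (Fintype.card (X v)) ≤ c * Real.log (Fintype.card S)) :
    informationRatio Γ ≤ ENNReal.ofReal c := by
  classical
  have hΩ0 : (Fintype.card Ω : ℝ≥0∞) ≠ 0 := by simp
  have hΩt : (Fintype.card Ω : ℝ≥0∞) ≠ ∞ := by simp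
  have hS0 : (Fintype.card S : ℝ≥0∞) ≠ 0 := by simp
  have hSt : (Fintype.card S : ℝ≥0∞) ≠ ∞ := by simp
  have hunif : ∀ s, (PMF.uniformOfFintype Ω).map σ s = (Fintype.card S : ℝ≥0∞)⁻¹ := by
    intro s
    have h := card_fiber_eq_card_mul_card_fiber σ (fun _ => ())
      (fun s => (hσ s).imp fun ω hω => ⟨hω, fun _ => rfl⟩) s ()
    simp only [Finset.filter_true, and_true, Finset.card_univ] at h
    have h' : (Fintype.card Ω : ℝ≥0∞) = Fintype.card S *
      ((Finset.univ.filter fun ω => σ ω = s).card : ℝ≥0∞) := by exact_mod_cast h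
    have hc0 : ((Finset.univ.filter fun ω => σ ω = s).card : ℝ≥0∞) ≠ 0 := by
      intro h0
      rw [h0, mul_zero] at h'
      exact hΩ0 h'
    rw [PMF.map_uniformOfFintype_apply, h', mul_comm, ENNReal.div_eq_inv_mul,
      ENNReal.mul_inv (Or.inl hc0) (Or.inl (by simp)), mul_comm, ← mul_assoc,
      ENNReal.mul_inv_cancel hc0 (by simp), one_mul]
  have hH := shannonEntropy_eq_log_card _ hunif
  have hlogS : 0 < Real.log (Fintype.card S) :=
    Real.log_pos (by exact_mod_cast Fintype.one_lt_card)
  have hlog2 : 0 < Real.log 2 := Real.log_pos one_lt_two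
  let 𝒮 : SecretSharingScheme V :=
    { Ω := Ω
      P := PMF.uniformOfFintype Ω
      Secret := S
      Share := X
      secret := σ
      share := fun v => sh v
      entropy_secret_pos := by rw [hH]; positivity }
  refine iInf₂_le_of_le 𝒮 ⟨fun A hA => ?_, fun A hA s a => ?_⟩ (iSup_le fun v => ?_)
  -- Decoding by any preimage is sound: two preimages differ by an element with zero shares on `A`,
  -- on which `σ` vanishes.
  · refine ⟨fun a => if h : ∃ ω, 𝒮.shares A ω = a then σ h.choose else 0, fun ω _ => ?_⟩
    have h : ∃ ω', 𝒮.shares A ω' = 𝒮.shares A ω := ⟨ω, rfl⟩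
    have hsp := h.choose_spec
    simp only [dif_pos h]
    change σ h.choose = σ ω
    rw [← sub_eq_zero, ← map_sub]
    refine hrec A hA _ fun v hv => ?_
    rw [map_sub, sub_eq_zero]
    exact congrFun hsp ⟨v, hv⟩
  · have h := card_fiber_eq_card_mul_card_fiber σ (𝒮.shares A)
      (fun s => (hpriv A hA s).imp fun ω hω => ⟨hω.1, fun ω' => by
        funext v
        change sh v (ω' + ω) = sh v ω'
        rw [map_add, hω.2 v v.2, add_zero]⟩) s a
    change (PMF.uniformOfFintype Ω).map _ _ = (PMF.uniformOfFintype Ω).map σ s *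
      (PMF.uniformOfFintype Ω).map _ _
    rw [hunif, PMF.map_uniformOfFintype_apply, PMF.map_uniformOfFintype_apply, h, Nat.cast_mul,
      mul_div_assoc, ← mul_assoc, ENNReal.inv_mul_cancel hS0 hSt, one_mul]
    simp only [Prod.mk.injEq]
    rfl
  · refine ENNReal.ofReal_le_ofReal ?_
    change shannonEntropy _ / shannonEntropy ((PMF.uniformOfFintype Ω).map σ) ≤ c
    rw [hH, div_le_iff₀ (by positivity), ← mul_div_assoc]
    exact (shannonEntropy_le_log_card _).trans
      (div_le_div_of_nonneg_right (hc v) hlog2.le)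

end LinearScheme

/-- Decomposition into complete multipartite pieces: in the piece `i`, the participant `v` belongs to
the part `lab i v` (if any), and every transversal of the parts determines the symbol number `i` of
a Reed-Solomon code word of the secret. -/
theorem informationRatio_le_of_labelling {V : Type u} {Γ : Set (Set V)} {I J : Type} [Fintype I]
    [Fintype J] [DecidableEq J] [Nonempty J] (lab : I → V → Option J) (m L : ℕ) (hm : 0 < m)
    (hcov : ∀ A ∈ Γ, ∃ T : Finset I, m ≤ T.card ∧
      ∀ i ∈ T, ∀ j, ∃ v ∈ A, lab i v = some j)
    (hpriv : ∀ A ∉ Γ, ∀ i, ∃ j, ∀ v ∈ A, lab i v ≠ some j)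
    (hload : ∀ v, Nat.card {i // (lab i v).isSome} ≤ L) :
    informationRatio Γ ≤ ENNReal.ofReal ((L : ℝ) / m) := by
  classical
  -- The field must have `|I|` distinct evaluation points.
  obtain ⟨p, hpI, hp⟩ := Nat.exists_infinite_primes (Fintype.card I)
  have : Fact p.Prime := ⟨hp⟩
  have : Nonempty (Fin m) := ⟨⟨0, hm⟩⟩
  have j₀ : J := Classical.arbitrary J
  obtain ⟨x⟩ : Nonempty (I ↪ ZMod p) :=
    Function.Embedding.nonempty_of_card_le (by rwa [ZMod.card])
  let y : I → ((Fin m → ZMod p) × (I → J → ZMod p)) →+ ZMod p := fun i =>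
    { toFun := fun ω => ∑ k : Fin m, ω.1 k * x i ^ (k : ℕ)
      map_zero' := by simp
      map_add' := fun a b => by simp [add_mul, Finset.sum_add_distrib] }
  -- The correction at `j₀` cancels the random value there and forces the summands to add up to `y
  -- i`.
  let z : I → J → ((Fin m → ZMod p) × (I → J → ZMod p)) →+ ZMod p := fun i j =>
    { toFun := fun ω => ω.2 i j + if j = j₀ then y i ω - ∑ j', ω.2 i j' else 0
      map_zero' := by simp
      map_add' := fun a b => by
        split_ifs
        · simp [Finset.sum_add_distrib]; ring
        · simp }
  have hz : ∀ i ω, ∑ j, z i j ω = y i ω := fun i ω => by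
    simp [z, Finset.sum_add_distrib]
  refine informationRatio_le_of_addMonoidHom
    (X := fun v => {i // (lab i v).isSome} → ZMod p) (AddMonoidHom.fst _ _)
    (fun v => AddMonoidHom.mk' (fun ω i => z i.1 ((lab i.1 v).get i.2) ω)
      fun a b => by funext i; simp) (fun s => ⟨(s, 0), rfl⟩) ?_ ?_ _ ?_
  · intro A hA ω hω
    obtain ⟨T, hT, hT'⟩ := hcov A hA
    have hy : ∀ i ∈ T, y i ω = 0 := by
      intro i hi
      rw [← hz]
      refine Finset.sum_eq_zero fun j _ => ?_
      obtain ⟨v, hv, hj⟩ := hT' i hi j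
      have := congrFun (hω v hv) ⟨i, by simp [hj]⟩
      simpa [hj] using this
    obtain ⟨e⟩ : Nonempty (Fin m ↪ T) := Function.Embedding.nonempty_of_card_le (by simpa using hT)
    change ω.1 = 0
    exact Matrix.eq_zero_of_forall_index_sum_mul_pow_eq_zero (f := fun k => x (e k).1)
      (fun a b h => e.injective (Subtype.ext (x.injective h))) fun k => hy _ (e k).2
  · intro A hA s
    choose j hj using hpriv A hA
    have hy : ∀ r r', y r' (s, r) = y r' (s, 0) := fun _ _ => rfl
    -- The whole symbol `y i` is placed on the missing part `j i`. The random values then already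
    -- add up to `y i`, so the correction at `j₀` vanishes and all other parts receive zero.
    refine ⟨(s, fun i j' => if j' = j i then y i (s, 0) else 0), rfl, fun v hv => ?_⟩
    funext i
    have hne : (lab i.1 v).get i.2 ≠ j i.1 := fun h => hj i.1 v hv (by simp [← h])
    simp [z, hne, hy]
  · intro v
    have hm' : (0 : ℝ) < m := by exact_mod_cast hm
    have hp1 : (0 : ℝ) ≤ Real.log p := Real.log_natCast_nonneg p
    have hl : (Fintype.card {i // (lab i v).isSome} : ℝ) ≤ L := by
      rw [← Nat.card_eq_fintype_card]; exact_mod_cast hload v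
    simp only [Fintype.card_fun, ZMod.card, Fintype.card_fin, Nat.cast_pow, Real.log_pow]
    rw [← mul_assoc, div_mul_cancel₀ _ hm'.ne']
    gcongr
end

/-! ### From biclique covers of link graphs to schemes -/

noncomputable section

/-- `μ`-fold cover of the edges of a graph by complete bipartite subgraphs indexed by `I`, in which
every vertex belongs to at most `ℓ` of the subgraphs. -/
structure SimpleGraph.BicliqueCover {V : Type*} (G : SimpleGraph V) (I : Type*) (μ ℓ : ℕ) where
  /-- the left side of a subgraph -/
  left : I → Set V
  /-- the right side of a subgraph -/
  right : I → Set V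
  adj : ∀ i, ∀ a ∈ left i, ∀ b ∈ right i, G.Adj a b
  cover : ∀ a b, G.Adj a b →
    μ ≤ Nat.card {i // (a ∈ left i ∧ b ∈ right i) ∨ (b ∈ left i ∧ a ∈ right i)}
  load : ∀ v, Nat.card {i // v ∈ left i ∨ v ∈ right i} ≤ ℓ

/-- The graph of the pairs that complete the range of an injective tuple to a hyperedge. -/
def linkGraph {V : Type*} (E : Set (Set V)) {t : ℕ} (f : Fin t → V) : SimpleGraph V where
  Adj a b := a ≠ b ∧ Function.Injective f ∧ a ∉ Set.range f ∧ b ∉ Set.range f ∧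
    insert a (insert b (Set.range f)) ∈ E
  symm := ⟨fun a b ⟨h1, h2, h3, h4, h5⟩ => ⟨h1.symm, h2, h4, h3, by rwa [Set.insert_comm]⟩⟩
  loopless := ⟨fun _ h => h.1 rfl⟩

/-- Overwriting the known coordinate `k` by an arbitrary vertex loses no information. The product
form avoids the exponent `t - 1`. -/
theorem card_mul_card_tuples_apply_eq_le {V : Type*} [Fintype V] {t : ℕ} (k : Fin t) (v : V) :
    Fintype.card V * Nat.card {f : Fin t → V // f k = v} ≤ Fintype.card V ^ t := by
  classical
  have : Fintype.card V ^ t = Nat.card (Fin t → V) := by simp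
  rw [this, ← Nat.card_eq_fintype_card, ← Nat.card_prod]
  refine Nat.card_le_card_of_injective
    (fun x : V × {f : Fin t → V // f k = v} => Function.update x.2.1 k x.1) ?_
  rintro ⟨w, f, hf⟩ ⟨w', f', hf'⟩ h
  have hw : w = w' := by simpa using congrFun h k
  have hff : f = f' := by
    funext j
    by_cases hj : j = k
    · rw [hj, hf, hf']
    · simpa [hj] using congrFun h j
  subst hw hff
  rfl

theorem card_mul_card_tuples_mem_range_le {V : Type*} [Fintype V] {t : ℕ} (v : V) :
    Fintype.card V * Nat.card {f : Fin t → V // v ∈ Set.range f} ≤ t * Fintype.card V ^ t := by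
  classical
  have h : Nat.card {f : Fin t → V // v ∈ Set.range f}
      ≤ ∑ k : Fin t, Nat.card {f : Fin t → V // f k = v} := by
    rw [← Nat.card_sigma]
    refine Nat.card_le_card_of_injective
      (fun x : {f : Fin t → V // v ∈ Set.range f} =>
        (⟨x.2.choose, x.1, x.2.choose_spec⟩ : Σ k : Fin t, {f : Fin t → V // f k = v})) ?_
    intro x y hxy
    have := congrArg (fun s => s.2.1) hxy
    exact Subtype.ext this
  calc _ ≤ Fintype.card V * ∑ k : Fin t, Nat.card {f : Fin t → V // f k = v} := by gcongr
    _ = ∑ k : Fin t, Fintype.card V * Nat.card {f : Fin t → V // f k = v} := Finset.mul_sum ..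
    _ ≤ ∑ k : Fin t, Fintype.card V ^ t :=
        Finset.sum_le_sum fun k _ => card_mul_card_tuples_apply_eq_le k v
    _ = _ := by simp

/-- The elements of a `(t + 2)`-set outside an embedded `t`-tuple form a pair. -/
theorem exists_pair_of_embedding {V : Type*} {t : ℕ} {e : Set V} (he : e.ncard = t + 2)
    (f : Fin t ↪ e) : ∃ a b, a ≠ b ∧ a ∉ Set.range (fun j => (f j : V)) ∧
      b ∉ Set.range (fun j => (f j : V)) ∧
      insert a (insert b (Set.range fun j => (f j : V))) = e := by
  have hfin : e.Finite := Set.finite_of_ncard_pos (by omega)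
  set R : Set V := Set.range fun j => (f j : V)
  have hR : R ⊆ e := by rintro _ ⟨j, rfl⟩; exact (f j).2
  have hRc : R.ncard = t := by
    have hinj : Function.Injective fun j => (f j : V) := Subtype.val_injective.comp f.injective
    rw [← Nat.card_coe_set_eq, Nat.card_range_of_injective hinj, Nat.card_fin]
  have hd : (e \ R).ncard = 2 := by
    rw [Set.ncard_sdiff hR (hfin.subset hR), he, hRc]; omega
  obtain ⟨a, b, hab, h⟩ := Set.ncard_eq_two.1 hd
  have ha : a ∈ e \ R := by rw [h]; simp
  have hb : b ∈ e \ R := by rw [h]; simp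
  refine ⟨a, b, hab, ha.2, hb.2, ?_⟩
  rw [← Set.sdiff_union_of_subset hR, h]
  ext x; simp [or_assoc]

/-- The label of `v` in the complete multipartite hypergraph with parts `A`, `B` and the singletons
of the range of `f`. -/
def partLabel {V : Type*} {t : ℕ} (f : Fin t → V) (A B : Set V) (v : V) :
    Option (Fin t ⊕ Bool) :=
  open Classical in
  if h : ∃ j, f j = v then some (Sum.inl h.choose)
  else if v ∈ A then some (Sum.inr false)
  else if v ∈ B then some (Sum.inr true)
  else none

section partLabel

variable {V : Type*} {t : ℕ} {f : Fin t → V} {A B : Set V} {v : V}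

theorem apply_eq_of_partLabel_eq {j : Fin t} (h : partLabel f A B v = some (Sum.inl j)) :
    f j = v := by
  unfold partLabel at h
  split_ifs at h with h1 h2 h3
  · simp only [Option.some.injEq, Sum.inl.injEq] at h
    rw [← h]; exact h1.choose_spec
  all_goals simp at h

theorem mem_left_of_partLabel_eq (h : partLabel f A B v = some (Sum.inr false)) : v ∈ A := by
  unfold partLabel at h
  split_ifs at h with h1 h2 h3 <;> simp_all

theorem mem_right_of_partLabel_eq (h : partLabel f A B v = some (Sum.inr true)) : v ∈ B := by
  unfold partLabel at h
  split_ifs at h with h1 h2 h3 <;> simp_all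

theorem partLabel_apply (hf : Function.Injective f) (j : Fin t) :
    partLabel f A B (f j) = some (Sum.inl j) := by
  have h : ∃ j', f j' = f j := ⟨j, rfl⟩
  rw [partLabel, dif_pos h, hf h.choose_spec]

theorem partLabel_of_mem_left (hf : v ∉ Set.range f) (hv : v ∈ A) :
    partLabel f A B v = some (Sum.inr false) := by
  rw [partLabel, dif_neg (by simpa using hf), if_pos hv]

theorem partLabel_of_mem_right (hf : v ∉ Set.range f) (hA : v ∉ A) (hv : v ∈ B) :
    partLabel f A B v = some (Sum.inr true) := by
  rw [partLabel, dif_neg (by simpa using hf), if_neg hA, if_pos hv]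

theorem of_isSome_partLabel (h : (partLabel f A B v).isSome) :
    v ∈ Set.range f ∨ v ∈ A ∨ v ∈ B := by
  unfold partLabel at h
  split_ifs at h with h1 h2 h3 <;> simp_all

end partLabel

/-- Each of the `(t + 2).descFactorial t` embeddings of `Fin t` into a hyperedge leaves one edge of
a link graph, which is covered `μ` times. A vertex on the tuple is a part of its own in possibly all
`|I|` pieces of that tuple; off the tuple it lies in at most `ℓ`. -/
theorem informationRatio_le_of_bicliqueCover_aux {V : Type u} [Fintype V] {E : Set (Set V)}
    {t : ℕ} (hE : ∀ e ∈ E, e.ncard = t + 2) {I : Type*} [Fintype I] {μ ℓ : ℕ} (hμ : 0 < μ)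
    (C : ∀ f : Fin t → V, (linkGraph E f).BicliqueCover I μ ℓ) (L : ℕ)
    (hL : ∀ v : V, Nat.card {f : Fin t → V // v ∈ Set.range f} * Fintype.card I
      + Fintype.card V ^ t * ℓ ≤ L) :
    informationRatio {A : Set V | ∃ e ∈ E, e ⊆ A}
      ≤ ENNReal.ofReal ((L : ℝ) / ((t + 2).descFactorial t * μ : ℕ)) := by
  classical
  let K := (Fin t → V) × I
  -- Reindexing moves the pieces from the universe of `V` to `Type`, where the scheme must live.
  let κ : Fin (Fintype.card K) ≃ K := (Fintype.equivFin K).symm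
  let lab : K → V → Option (Fin t ⊕ Bool) := fun i => partLabel i.1 ((C i.1).left i.2)
    ((C i.1).right i.2)
  refine informationRatio_le_of_labelling (fun i => lab (κ i)) _ L
    (Nat.mul_pos (Nat.descFactorial_pos.2 (by omega)) hμ) ?_ ?_ ?_
  · rintro A ⟨e, he, heA⟩
    have hec := hE e he
    have hfin : e.Finite := Set.finite_of_ncard_pos (by omega)
    have := hfin.fintype
    let S : Finset K := Finset.univ.filter fun i => ∀ j, ∃ v ∈ A, lab i v = some j
    refine ⟨S.map κ.symm.toEmbedding, ?_, ?_⟩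
    · rw [Finset.card_map]
      have hemb : (t + 2).descFactorial t = Fintype.card (Fin t ↪ e) := by
        rw [Fintype.card_embedding_eq, Fintype.card_fin, ← hec, ← Nat.card_coe_set_eq,
          Nat.card_eq_fintype_card]
      rw [hemb]
      choose a b hab ha hb hins using fun f : Fin t ↪ e => exists_pair_of_embedding hec f
      have hinj : ∀ f : Fin t ↪ e, Function.Injective fun j => (f j : V) := fun f =>
        Subtype.val_injective.comp f.injective
      have hadj : ∀ f : Fin t ↪ e, (linkGraph E fun j => (f j : V)).Adj (a f) (b f) := fun f =>
        ⟨hab f, hinj f, ha f, hb f, by rw [hins]; exact he⟩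
      have hq : ∀ (f : Fin t ↪ e) (i : I),
          (a f ∈ (C fun j => (f j : V)).left i ∧ b f ∈ (C fun j => (f j : V)).right i) ∨
            (b f ∈ (C fun j => (f j : V)).left i ∧ a f ∈ (C fun j => (f j : V)).right i) →
          ((fun j => (f j : V)), i) ∈ S := by
        intro f i hi
        simp only [S, Finset.mem_filter, Finset.mem_univ, true_and]
        have key : ∀ x y, x ∈ e → y ∈ e → x ∉ Set.range (fun j => (f j : V)) →
            y ∉ Set.range (fun j => (f j : V)) → x ∈ (C fun j => (f j : V)).left i →
            y ∈ (C fun j => (f j : V)).right i →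
            ∀ j, ∃ v ∈ A, lab ((fun j => (f j : V)), i) v = some j := by
          intro x y hx hy hxr hyr hxl hyl j
          have hyn : y ∉ (C fun j => (f j : V)).left i := fun h =>
            ((C _).adj i y h y hyl).ne rfl
          rcases j with j | _ | _
          · exact ⟨f j, heA (f j).2, partLabel_apply (hinj f) j⟩
          · exact ⟨x, heA hx, partLabel_of_mem_left hxr hxl⟩
          · exact ⟨y, heA hy, partLabel_of_mem_right hyr hyn hyl⟩
        have hae : a f ∈ e := by rw [← hins f]; simp
        have hbe : b f ∈ e := by rw [← hins f]; simp
        rcases hi with hi | hi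
        · exact key _ _ hae hbe (ha f) (hb f) hi.1 hi.2
        · exact key _ _ hbe hae (hb f) (ha f) hi.1 hi.2
      calc Fintype.card (Fin t ↪ e) * μ = ∑ f : Fin t ↪ e, μ := by simp
        _ ≤ ∑ f : Fin t ↪ e, Nat.card {i // (a f ∈ (C fun j => (f j : V)).left i ∧
              b f ∈ (C fun j => (f j : V)).right i) ∨ (b f ∈ (C fun j => (f j : V)).left i ∧
              a f ∈ (C fun j => (f j : V)).right i)} :=
            Finset.sum_le_sum fun f _ => (C _).cover _ _ (hadj f)
        _ ≤ Nat.card S := by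
            rw [← Nat.card_sigma]
            refine Nat.card_le_card_of_injective
              (fun x => ⟨((fun j => (x.1 j : V)), x.2.1), hq x.1 x.2.1 x.2.2⟩) ?_
            rintro ⟨f, i, hi⟩ ⟨f', i', hi'⟩ h
            have h1 := congrArg (fun x => x.1.1) h
            have h2 : i = i' := congrArg (fun x => x.1.2) h
            subst h2
            obtain rfl : f = f' := by
              ext j
              exact congrFun h1 j
            rfl
        _ = S.card := by simp
    · intro i hi
      obtain ⟨k, hk, rfl⟩ := Finset.mem_map.1 hi
      simpa [S] using hk
  · intro A hA i
    by_contra! h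
    obtain ⟨a, haA, ha⟩ := h (Sum.inr false)
    obtain ⟨b, hbA, hb⟩ := h (Sum.inr true)
    obtain ⟨-, -, -, -, he⟩ := (C _).adj _ a (mem_left_of_partLabel_eq ha) b
      (mem_right_of_partLabel_eq hb)
    refine hA ⟨_, he, Set.insert_subset haA (Set.insert_subset hbA ?_)⟩
    rintro _ ⟨j, rfl⟩
    obtain ⟨v, hv, hj⟩ := h (Sum.inl j)
    rwa [apply_eq_of_partLabel_eq hj]
  · intro v
    refine le_trans ?_ (hL v)
    have hsum : Fintype.card V ^ t * ℓ = ∑ f : Fin t → V, ℓ := by simp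
    calc Nat.card {i // (lab (κ i) v).isSome} = Nat.card {k : K // (lab k v).isSome} :=
          Nat.card_congr (κ.subtypeEquiv fun _ => Iff.rfl)
      _ ≤ Nat.card (({f : Fin t → V // v ∈ Set.range f} × I) ⊕
            (Σ f : Fin t → V, {i // v ∈ (C f).left i ∨ v ∈ (C f).right i})) := by
          refine Nat.card_le_card_of_injective (fun k => if h : v ∈ Set.range k.1.1 then
              Sum.inl (⟨k.1.1, h⟩, k.1.2)
            else Sum.inr ⟨k.1.1, k.1.2, (of_isSome_partLabel k.2).resolve_left h⟩) ?_
          rintro ⟨⟨f, i⟩, hk⟩ ⟨⟨f', i'⟩, hk'⟩ h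
          refine Subtype.ext (Prod.ext_iff.2 ?_)
          dsimp only at h ⊢
          split_ifs at h with h1 h2 h2
          · simpa using h
          · simp only [Sum.inr.injEq, Sigma.mk.injEq] at h
            obtain ⟨rfl, h⟩ := h
            simpa using h
      _ = Nat.card {f : Fin t → V // v ∈ Set.range f} * Fintype.card I +
            ∑ f : Fin t → V, Nat.card {i // v ∈ (C f).left i ∨ v ∈ (C f).right i} := by
          rw [Nat.card_sum, Nat.card_prod, Nat.card_sigma, Nat.card_eq_fintype_card (α := I)]
      _ ≤ _ := by
          rw [hsum]
          gcongr with f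
          exact (C f).load v

/-- A hypergraph all of whose link graphs have biclique covers with the same parameters. -/
theorem informationRatio_le_of_bicliqueCover {V : Type u} [Fintype V] {E : Set (Set V)}
    {t : ℕ} (hE : ∀ e ∈ E, e.ncard = t + 2) {I : Type*} [Fintype I] {μ ℓ : ℕ} (hμ : 0 < μ)
    (C : ∀ f : Fin t → V, (linkGraph E f).BicliqueCover I μ ℓ) (hV : 0 < Fintype.card V) (c : ℝ)
    (hc : (2 / μ : ℝ) * (ℓ + t * Fintype.card I / Fintype.card V) ≤ c) :
    informationRatio {A : Set V | ∃ e ∈ E, e ⊆ A}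
      ≤ ENNReal.ofReal ((Fintype.card V : ℝ) ^ t / (t + 2)! * c) := by
  set n := Fintype.card V
  obtain ⟨L, hL, hL'⟩ : ∃ L : ℕ, (∀ v : V, Nat.card {f : Fin t → V // v ∈ Set.range f} *
      Fintype.card I + n ^ t * ℓ ≤ L) ∧ n * L ≤ t * n ^ t * Fintype.card I + n * (n ^ t * ℓ) := by
    refine ⟨t * n ^ t / n * Fintype.card I + n ^ t * ℓ, fun v => ?_, ?_⟩
    · gcongr
      rw [Nat.le_div_iff_mul_le hV, mul_comm]
      exact card_mul_card_tuples_mem_range_le v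
    · rw [mul_add, ← mul_assoc n]
      exact Nat.add_le_add_right (Nat.mul_le_mul_right _ (Nat.mul_div_le _ _)) _
  refine (informationRatio_le_of_bicliqueCover_aux hE hμ C L hL).trans
    (ENNReal.ofReal_le_ofReal (le_trans ?_ (mul_le_mul_of_nonneg_left hc (by positivity))))
  have hn : (0 : ℝ) < n := by exact_mod_cast hV
  have hμ' : (0 : ℝ) < μ := by exact_mod_cast hμ
  have hfac : (2 : ℝ) * (t + 2).descFactorial t = (t + 2)! := by
    have := Nat.factorial_mul_descFactorial (show t ≤ t + 2 by omega)
    rw [show t + 2 - t = 2 by omega] at this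
    exact_mod_cast this
  have hdpos : (0 : ℝ) < (t + 2).descFactorial t := by
    exact_mod_cast Nat.descFactorial_pos.2 (by omega)
  have hLr : (n : ℝ) * L ≤ t * n ^ t * Fintype.card I + n * (n ^ t * ℓ) := by exact_mod_cast hL'
  rw [← hfac, Nat.cast_mul, div_le_iff₀ (by positivity)]
  calc (L : ℝ) = n * L / n := by field_simp
    _ ≤ (t * n ^ t * Fintype.card I + n * (n ^ t * ℓ)) / n := by gcongr
    _ = _ := by field_simp; ring
end

noncomputable section

/-! ### The cover for arbitrary graphs -/

section ChunkCover

variable {V : Type*} [Fintype V] (G : SimpleGraph V) {q k : ℕ}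

/-- The neighbours of `w` in the chunk `j`. -/
def chunkTrace (g : V → Fin q) (h : V → Fin k) (j : Fin q) (w : V) : Finset (Fin k) :=
  open Classical in Finset.univ.filter fun t => ∃ a, g a = j ∧ h a = t ∧ G.Adj a w

/-- The vertices are divided into chunks. Vertices outside a chunk with the same neighbours in this
chunk are taken together, the edges inside the chunks are covered by stars. -/
def chunkCover (g : V → Fin q) (h : V → Fin k)
    (hgh : ∀ a b, g a = g b → h a = h b → a = b) :
    G.BicliqueCover ((Fin q × Finset (Fin k)) ⊕ V) 2 (2 ^ k + q + 1 + k) where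
  left := Sum.elim (fun x => {a | g a = x.1 ∧ h a ∈ x.2}) fun a => {a}
  right := Sum.elim (fun x => {w | g w ≠ x.1 ∧ chunkTrace G g h x.1 w = x.2})
    fun a => {b | G.Adj a b ∧ g b = g a}
  adj := by
    rintro (⟨j, S⟩ | v) a ha b hb
    · change g a = j ∧ h a ∈ S at ha
      change g b ≠ j ∧ chunkTrace G g h j b = S at hb
      obtain ⟨ha1, ha2⟩ := ha
      obtain ⟨hb1, rfl⟩ := hb
      simp only [chunkTrace, Finset.mem_filter, Finset.mem_univ, true_and] at ha2
      obtain ⟨a', h1, h2, h3⟩ := ha2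
      rwa [← hgh a' a (h1.trans ha1.symm) h2]
    · obtain rfl : a = v := ha
      exact hb.1
  cover := by
    classical
    intro a b hab
    have hmem : ∀ {x y}, G.Adj x y → h x ∈ chunkTrace G g h (g x) y := fun {x y} hxy => by
      simp only [chunkTrace, Finset.mem_filter, Finset.mem_univ, true_and]
      exact ⟨x, rfl, rfl, hxy⟩
    rw [Nat.card_eq_fintype_card, Nat.succ_le_iff, Fintype.one_lt_card_iff]
    -- An edge inside a chunk lies in the stars of both endpoints; a crossing edge is covered once
    -- from the chunk of each endpoint.
    by_cases hg : g a = g b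
    · exact ⟨⟨Sum.inr a, Or.inl ⟨rfl, hab, hg.symm⟩⟩, ⟨Sum.inr b, Or.inr ⟨rfl, hab.symm, hg⟩⟩,
        by simpa using hab.ne⟩
    · exact ⟨⟨Sum.inl (g a, chunkTrace G g h (g a) b),
          Or.inl ⟨⟨rfl, hmem hab⟩, Ne.symm hg, rfl⟩⟩,
        ⟨Sum.inl (g b, chunkTrace G g h (g b) a), Or.inr ⟨⟨rfl, hmem hab.symm⟩, hg, rfl⟩⟩,
        by simp [hg]⟩
  load := by
    classical
    intro v
    have hcard : Nat.card (((Finset (Fin k) ⊕ Fin q) ⊕ Unit) ⊕ Fin k) = 2 ^ k + q + 1 + k := by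
      simp
    rw [← hcard]
    -- In its own chunk `v` may meet every subset. In another chunk only its trace counts, so the
    -- chunk number suffices. Stars through `v` are centred in its chunk.
    let F : ((Fin q × Finset (Fin k)) ⊕ V) → ((Finset (Fin k) ⊕ Fin q) ⊕ Unit) ⊕ Fin k :=
      Sum.elim (fun x => if g v = x.1 then Sum.inl (Sum.inl (Sum.inl x.2))
          else Sum.inl (Sum.inl (Sum.inr x.1)))
        fun a => if a = v then Sum.inl (Sum.inr ()) else Sum.inr (h a)
    refine Nat.card_le_card_of_injective (fun i => F i.1) ?_
    rintro ⟨⟨j, S⟩ | a, hi⟩ ⟨⟨j', S'⟩ | a', hi'⟩ hF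
    · simp only [F, Sum.elim_inl] at hF
      simp only [Sum.elim_inl, Set.mem_ofPred_eq] at hi hi'
      split_ifs at hF with h1 h2 h2
      · simp only [Sum.inl.injEq] at hF
        simp [← h1, ← h2, hF]
      · simp at hF
      · simp at hF
      · simp only [Sum.inl.injEq, Sum.inr.injEq] at hF
        subst hF
        have e1 := (hi.resolve_left fun hh => h1 hh.1).2
        have e2 := (hi'.resolve_left fun hh => h1 hh.1).2
        simp [← e1, ← e2]
    · simp only [F, Sum.elim_inl, Sum.elim_inr] at hF
      split_ifs at hF <;> simp at hF
    · simp only [F, Sum.elim_inl, Sum.elim_inr] at hF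
      split_ifs at hF <;> simp at hF
    · simp only [F, Sum.elim_inr] at hF
      simp only [Sum.elim_inr, Set.mem_ofPred_eq, Set.mem_singleton_iff] at hi hi'
      split_ifs at hF with h1 h2 h2
      · simp [h1, h2]
      · simp only [Sum.inr.injEq] at hF
        have e1 := (hi.resolve_left fun hh => h1 hh.symm).2
        have e2 := (hi'.resolve_left fun hh => h2 hh.symm).2
        simp [hgh a a' (e1.symm.trans e2) hF]

end ChunkCover

/-! ### The averaged cover for dense graphs -/

section RandomCover

open Classical in
-- Divided by `(s + 1) ^ |W|`, this is the probability that a random set of density `1 / (s + 1)`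
-- contains `Z` and misses `M`. Using all functions at once makes the random cover deterministic.
theorem card_functions_zero_on_ne_zero_on {W : Type*} [Fintype W] (s : ℕ) (Z M : Finset W)
    (hZM : Disjoint Z M) :
    Nat.card {c : W → Fin (s + 1) // (∀ x ∈ Z, c x = 0) ∧ ∀ x ∈ M, c x ≠ 0}
      = s ^ M.card * (s + 1) ^ (Fintype.card W - Z.card - M.card) := by
  have h : (Finset.univ.filter fun c : W → Fin (s + 1) =>
      (∀ x ∈ Z, c x = 0) ∧ ∀ x ∈ M, c x ≠ 0) = Fintype.piFinset fun x : W =>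
        if x ∈ M then ({0}ᶜ : Finset (Fin (s + 1))) else if x ∈ Z then {0} else Finset.univ := by
    ext c
    simp only [Finset.mem_filter, Finset.mem_univ, true_and, Fintype.mem_piFinset]
    constructor
    · rintro ⟨h1, h2⟩ x
      split_ifs with hM hZ
      · simpa using h2 x hM
      · simpa using h1 x hZ
      · simp
    · intro h
      refine ⟨fun x hx => ?_, fun x hx => ?_⟩
      · have := h x
        rw [if_neg (Finset.disjoint_left.1 hZM hx), if_pos hx] at this
        simpa using this
      · have := h x
        rw [if_pos hx] at this
        simpa using this
  rw [Nat.card_eq_fintype_card, Fintype.card_subtype, h, Fintype.card_piFinset]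
  have hcard : ∀ x : W, (if x ∈ M then ({0}ᶜ : Finset (Fin (s + 1))) else if x ∈ Z then {0}
      else Finset.univ).card = if x ∈ M then s else if x ∈ Z then 1 else s + 1 := by
    intro x
    split_ifs <;> simp [Finset.card_compl]
  simp only [hcard]
  rw [Finset.prod_ite, Finset.prod_ite]
  simp only [Finset.prod_const, one_pow, one_mul]
  have e1 : (Finset.univ.filter fun x => x ∈ M) = M := by simp
  have e2 : ((Finset.univ.filter fun x => x ∉ M).filter fun x => x ∉ Z) = (Z ∪ M)ᶜ := by
    ext x; simp; tauto
  rw [e1, e2, Finset.card_compl, Finset.card_union_of_disjoint hZM, Nat.sub_sub]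

variable {V : Type*} [Fintype V] (G : SimpleGraph V)

open Classical in
/-- The non-neighbours of `v`, completed to `m` elements by dummy vertices. -/
def paddedNonneighbors (m : ℕ) (v : V) : Finset (V ⊕ Fin m) :=
  (Finset.univ.filter fun w => ¬G.Adj v w).disjSum
    (Finset.univ.filter fun x : Fin m => (x : ℕ) < m - Nat.card {w // ¬G.Adj v w})

/-- Padding keeps the load down: a vertex with few non-neighbours would otherwise lie on the right
side too often. -/
theorem card_paddedNonneighbors {m : ℕ} {v : V} (hv : Nat.card {w // ¬G.Adj v w} ≤ m) :
    (paddedNonneighbors G m v).card = m := by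
  classical
  rw [paddedNonneighbors, Finset.card_disjSum, ← Fintype.card_subtype,
    ← Nat.card_eq_fintype_card, Fin.card_filter_val_lt]
  omega

theorem inl_mem_paddedNonneighbors {m : ℕ} {v w : V} :
    Sum.inl w ∈ paddedNonneighbors G m v ↔ ¬G.Adj v w := by
  simp [paddedNonneighbors]

/-- The left side is the zero set of a function with values in `Fin (s + 1)`, the right side
consists of common neighbours. -/
def zeroSetCover (m s : ℕ) (hG : ∀ v w, G.Adj v w → Nat.card {w // ¬G.Adj v w} ≤ m) :
    G.BicliqueCover (V ⊕ Fin m → Fin (s + 1)) (2 * (s ^ m * (s + 1) ^ (Fintype.card V - 1)))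
      ((s + 1) ^ (Fintype.card V + m - 1) + s ^ m * (s + 1) ^ Fintype.card V) where
  left c := {a | c (Sum.inl a) = 0}
  -- Isolated vertices are excluded, as nothing bounds the number of their non-neighbours.
  right c := {b | (∃ w, G.Adj b w) ∧ ∀ x ∈ paddedNonneighbors G m b, c x ≠ 0}
  adj c a ha b hb := by
    by_contra h
    exact hb.2 (Sum.inl a) ((inl_mem_paddedNonneighbors G).2 fun h' => h h'.symm) ha
  cover a b hab := by
    classical
    have key : ∀ a b, G.Adj a b → Nat.card {c : V ⊕ Fin m → Fin (s + 1) // c (Sum.inl a) = 0 ∧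
        ∀ x ∈ paddedNonneighbors G m b, c x ≠ 0} = s ^ m * (s + 1) ^ (Fintype.card V - 1) := by
      intro a b hab
      have h := card_functions_zero_on_ne_zero_on s {Sum.inl a} (paddedNonneighbors G m b) (by
        rw [Finset.disjoint_singleton_left, inl_mem_paddedNonneighbors, not_not]
        exact hab.symm)
      rw [card_paddedNonneighbors G (hG _ _ hab.symm), Finset.card_singleton, Fintype.card_sum,
        Fintype.card_fin, show Fintype.card V + m - 1 - m = Fintype.card V - 1 by omega] at h
      rw [← h]
      simp
    rw [two_mul]
    nth_rewrite 1 [← key a b hab]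
    rw [← key b a hab.symm, ← Nat.card_sum]
    -- Since `v` is its own non-neighbour, it is never on both sides. Hence the two orientations of
    -- an edge are counted disjointly.
    have h0 : ∀ (c : V ⊕ Fin m → Fin (s + 1)) (v : V), c (Sum.inl v) = 0 →
        ¬∀ x ∈ paddedNonneighbors G m v, c x ≠ 0 := fun c v h h' =>
      h' _ ((inl_mem_paddedNonneighbors G).2 (G.loopless.irrefl v)) h
    refine Nat.card_le_card_of_injective (Sum.elim
      (fun c => ⟨c.1, Or.inl ⟨c.2.1, ⟨a, hab.symm⟩, c.2.2⟩⟩)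
      fun c => ⟨c.1, Or.inr ⟨c.2.1, ⟨b, hab⟩, c.2.2⟩⟩) ?_
    rintro (⟨c, hc⟩ | ⟨c, hc⟩) (⟨c', hc'⟩ | ⟨c', hc'⟩) h
    · simpa using h
    · obtain rfl : c = c' := by simpa using h
      exact absurd hc'.2 (h0 _ _ hc.1)
    · obtain rfl : c = c' := by simpa using h
      exact absurd hc'.2 (h0 _ _ hc.1)
    · simpa using h
  load v := by
    classical
    have h1 := card_functions_zero_on_ne_zero_on s {(Sum.inl v : V ⊕ Fin m)} ∅
      (Finset.disjoint_empty_right _)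
    simp only [Finset.mem_singleton, forall_eq, Finset.notMem_empty, false_imp_iff, imp_true_iff,
      and_true, Finset.card_empty, pow_zero, one_mul, Finset.card_singleton, Fintype.card_sum,
      Fintype.card_fin, tsub_zero] at h1
    have h2 : Nat.card {c : V ⊕ Fin m → Fin (s + 1) // (∃ w, G.Adj v w) ∧
        ∀ x ∈ paddedNonneighbors G m v, c x ≠ 0} ≤ s ^ m * (s + 1) ^ Fintype.card V := by
      by_cases hv : ∃ w, G.Adj v w
      · obtain ⟨w, hw⟩ := hv
        have h := card_functions_zero_on_ne_zero_on s ∅ (paddedNonneighbors G m v)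
          (Finset.disjoint_empty_left _)
        rw [card_paddedNonneighbors G (hG _ _ hw), Finset.card_empty, Fintype.card_sum,
          Fintype.card_fin, tsub_zero, Nat.add_sub_cancel] at h
        rw [← h]
        refine Nat.card_le_card_of_injective (fun c => ⟨c.1, by simp, c.2.2⟩) ?_
        intro c c' h
        exact Subtype.ext (by simpa using h)
      · simp [hv]
    rw [← h1]
    refine le_trans ?_ (Nat.add_le_add_left h2 _)
    rw [← Nat.card_sum]
    refine Nat.card_le_card_of_injective (fun c => if h : c.1 (Sum.inl v) = 0 then
      Sum.inl ⟨c.1, h⟩ else Sum.inr ⟨c.1, c.2.resolve_left h⟩) ?_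
    rintro ⟨c, hc⟩ ⟨c', hc'⟩ h
    dsimp only at h
    split_ifs at h <;> simpa using h

end RandomCover
end

noncomputable section

/-! ### Explicit bounds with free parameters -/

section Uniform

variable {V : Type u} [Fintype V] {E : Set (Set V)} {t : ℕ}

theorem informationRatio_le_of_chunk_size (hE : ∀ e ∈ E, e.ncard = t + 2)
    (hV : 0 < Fintype.card V) {k : ℕ} (hk : 0 < k) :
    informationRatio {A : Set V | ∃ e ∈ E, e ⊆ A}
      ≤ ENNReal.ofReal ((Fintype.card V : ℝ) ^ t / (t + 2)! *
          ((Fintype.card V : ℝ) / k + (3 * t + 4) * 2 ^ k)) := by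
  set n := Fintype.card V
  let eV : V ≃ Fin n := Fintype.equivFin V
  have hdiv : ∀ v, (eV v : ℕ) / k < n / k + 1 := fun v =>
    Nat.lt_succ_of_le (Nat.div_le_div_right (eV v).2.le)
  refine informationRatio_le_of_bicliqueCover hE two_pos (fun f => chunkCover (linkGraph E f)
    (fun v => (⟨(eV v : ℕ) / k, hdiv v⟩ : Fin (n / k + 1)))
    (fun v => (⟨(eV v : ℕ) % k, Nat.mod_lt _ hk⟩ : Fin k)) fun a b h1 h2 => ?_) hV _ ?_
  · simp only [Fin.mk.injEq] at h1 h2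
    refine eV.injective (Fin.ext ?_)
    rw [← Nat.div_add_mod (eV a : ℕ) k, h1, h2, Nat.div_add_mod]
  · have hn : (0 : ℝ) < n := by exact_mod_cast hV
    have hn1 : (1 : ℝ) ≤ n := by exact_mod_cast hV
    have hq : ((n / k : ℕ) : ℝ) ≤ (n : ℝ) / k := Nat.cast_div_le
    have hq' : ((n / k : ℕ) : ℝ) ≤ n := by exact_mod_cast Nat.div_le_self n k
    have h2 : (1 : ℝ) ≤ 2 ^ k := one_le_pow₀ one_le_two
    have hk2 : (k : ℝ) ≤ 2 ^ k := by exact_mod_cast Nat.lt_two_pow_self.le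
    -- The pieces of tuples through a vertex cost `3 t * 2 ^ k`; the remaining `4 * 2 ^ k` absorbs
    -- `2 ^ k + 2 + k` from the load.
    have ht : (t : ℝ) * ((((n / k : ℕ) : ℝ) + 1) * 2 ^ k + n) / n ≤ t * (3 * 2 ^ k) := by
      rw [mul_div_assoc]
      gcongr
      rw [div_le_iff₀ hn]
      have : (((n / k : ℕ) : ℝ) + 1) * 2 ^ k ≤ (n + n) * 2 ^ k := by gcongr
      nlinarith
    simp only [Fintype.card_sum, Fintype.card_prod, Fintype.card_finset, Fintype.card_fin]
    push_cast
    rw [div_self two_ne_zero, one_mul]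
    change _ + (t : ℝ) * ((((n / k : ℕ) : ℝ) + 1) * 2 ^ k + n) / n ≤ _
    linarith

/-- With `p = 1 / (s + 1)`, `2 ℓ / μ = (p + (1 - p) ^ m) / (p (1 - p) ^ m) = (s + 1) + (1 + 1 / s) ^
m`. Tuples through a vertex add `t (1 + 1 / s) ^ m (s + 1) / n`, where the last quotient is at most
1. -/
theorem informationRatio_le_of_nonneighbors {m s : ℕ} (hE : ∀ e ∈ E, e.ncard = t + 2)
    (hG : ∀ (f : Fin t → V) (v w : V), (linkGraph E f).Adj v w →
      Nat.card {w // ¬(linkGraph E f).Adj v w} ≤ m)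
    (hs : 0 < s) (hsV : s + 1 ≤ Fintype.card V) :
    informationRatio {A : Set V | ∃ e ∈ E, e ⊆ A}
      ≤ ENNReal.ofReal ((Fintype.card V : ℝ) ^ t / (t + 2)! *
          (s + 1 + (t + 1) * Real.exp ((m : ℝ) / s))) := by
  classical
  obtain ⟨N, hN⟩ : ∃ N, Fintype.card V = N + 1 := ⟨Fintype.card V - 1, by omega⟩
  refine informationRatio_le_of_bicliqueCover hE (by positivity)
    (fun f => zeroSetCover (linkGraph E f) m s (hG f)) (by omega) _ ?_
  have hs' : (0 : ℝ) < s := by exact_mod_cast hs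
  have hexp : ((s + 1 : ℝ) / s) ^ m ≤ Real.exp ((m : ℝ) / s) := by
    rw [div_eq_mul_one_div (m : ℝ), Real.exp_nat_mul]
    gcongr
    rw [add_div, div_self hs'.ne', add_comm]
    exact Real.add_one_le_exp _
  have hle : (s + 1 : ℝ) / (N + 1) ≤ 1 := by
    rw [div_le_one (by positivity)]
    exact_mod_cast hsV.trans_eq hN
  have heq : (2 / ((2 * (s ^ m * (s + 1) ^ (Fintype.card V - 1)) : ℕ) : ℝ)) *
      (((s + 1) ^ (Fintype.card V + m - 1) + s ^ m * (s + 1) ^ Fintype.card V : ℕ) +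
        t * (Fintype.card (V ⊕ Fin m → Fin (s + 1)) : ℕ) / (Fintype.card V : ℕ))
      = s + 1 + ((s + 1 : ℝ) / s) ^ m * (t * ((s + 1) / (N + 1)) + 1) := by
    rw [Fintype.card_fun, Fintype.card_sum, Fintype.card_fin, Fintype.card_fin, hN,
      show N + 1 + m - 1 = N + m by omega, show N + 1 - 1 = N by omega]
    push_cast
    rw [div_pow]
    field_simp
    ring
  rw [heq, mul_comm (((s + 1 : ℝ) / s) ^ m)]
  gcongr
  exact mul_le_of_le_one_right (by positivity) hle

end Uniform

/-- Every hyperedge containing `v` and the tuple has exactly one further vertex, which is a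
neighbour of `v` in the link graph. -/
theorem card_nonneighbors_linkGraph_le {V : Type u} [Fintype V] {H : Hypergraph V} {t m : ℕ}
    (hdeg : ∀ T : Set V, T.ncard = t + 1 → (∃ e ∈ H.edgeSet, T ⊆ e) →
      (Fintype.card V : ℤ) - m ≤ H.setDegree T)
    (hE : ∀ e ∈ H.edgeSet, e.ncard = t + 2) (f : Fin t → V) (v w : V)
    (hvw : (linkGraph H.edgeSet f).Adj v w) :
    Nat.card {w // ¬(linkGraph H.edgeSet f).Adj v w} ≤ m := by
  classical
  obtain ⟨hne, hf, hv, hw, he⟩ := hvw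
  set T : Set V := insert v (Set.range f)
  have hT : T.ncard = t + 1 := by
    rw [Set.ncard_insert_of_notMem hv, ← Nat.card_coe_set_eq, Nat.card_range_of_injective hf,
      Nat.card_fin]
  have h1 := hdeg T hT ⟨_, he, Set.insert_subset_insert (Set.subset_insert _ _)⟩
  have h2 : H.setDegree T ≤ Nat.card {w // (linkGraph H.edgeSet f).Adj v w} := by
    have hsub : {e ∈ H.edgeSet | T ⊆ e} ⊆
        (fun w => insert w T) '' {w | (linkGraph H.edgeSet f).Adj v w} := by
      rintro e ⟨heE, hTe⟩
      have hc : (e \ T).ncard = 1 := by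
        rw [Set.ncard_sdiff hTe, hE e heE, hT]; omega
      obtain ⟨x, hx⟩ := Set.ncard_eq_one.1 hc
      have hxe : x ∈ e \ T := by rw [hx]; rfl
      have hins : insert x T = e := by
        rw [← Set.sdiff_union_of_subset hTe, hx]; rfl
      refine ⟨x, ⟨fun h => hxe.2 (h ▸ Set.mem_insert _ _), hf, hv,
        fun h => hxe.2 (Set.mem_insert_of_mem _ h), ?_⟩, hins⟩
      rw [Set.insert_comm]
      exact hins ▸ heE
    refine (Set.ncard_le_ncard hsub (Set.toFinite _)).trans ?_
    exact (Set.ncard_image_le (Set.toFinite _)).trans_eq (Nat.card_coe_set_eq _).symm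
  have h3 := Fintype.card_subtype_compl fun w => (linkGraph H.edgeSet f).Adj v w
  have h4 := Fintype.card_subtype_le fun w => (linkGraph H.edgeSet f).Adj v w
  rw [Nat.card_eq_fintype_card] at h2 ⊢
  omega

/-! ### Choice of the parameters -/

section Asymptotics

open Filter

theorem eventually_mul_rpow_mul_log_le {c : ℝ} (hc : c < 1) (K : ℝ) :
    ∀ᶠ x : ℝ in atTop, K * x ^ c * Real.log x ≤ x := by
  have h := (isLittleO_log_rpow_atTop (sub_pos.2 hc)).bound
    (c := (|K| + 1)⁻¹) (by positivity)
  filter_upwards [h, eventually_ge_atTop 1] with x hx hx1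
  have hx0 : 0 < x := by linarith
  have hlog : 0 ≤ Real.log x := Real.log_nonneg hx1
  rw [Real.norm_of_nonneg hlog, Real.norm_of_nonneg (by positivity),
    ← div_eq_inv_mul, le_div_iff₀ (by positivity)] at hx
  calc K * x ^ c * Real.log x ≤ (|K| + 1) * x ^ c * Real.log x := by
        gcongr
        linarith [le_abs_self K]
    _ = x ^ c * (Real.log x * (|K| + 1)) := by ring
    _ ≤ x ^ c * x ^ (1 - c) := by gcongr
    _ = x := by rw [← Real.rpow_add hx0]; simp

theorem exists_chunk_size (K ε : ℝ) (hK : 0 ≤ K) (hε : 0 < ε) :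
    ∀ᶠ n : ℕ in atTop, ∃ k : ℕ, 0 < k ∧
      (n : ℝ) / k + K * 2 ^ k ≤ (1 + ε) * (n / Real.logb 2 n) := by
  -- The chunk size is `⌊c log n⌋`: `c < 1` makes `2 ^ k ≤ n ^ c` negligible, and `(1 + ε / 2) c = 1
  -- + ε / 4` leaves room for the rounding once `log n` is large.
  set c : ℝ := (1 + ε / 4) / (1 + ε / 2) with hc
  have hc1 : c < 1 := by rw [hc, div_lt_one (by positivity)]; linarith
  have hc0 : 0 < c := by positivity
  have hlog2 : 0 < Real.log 2 := Real.log_pos one_lt_two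
  have hlogb : Tendsto (fun n : ℕ => Real.logb 2 n) atTop atTop :=
    (Real.tendsto_logb_atTop one_lt_two).comp tendsto_natCast_atTop_atTop
  filter_upwards [tendsto_natCast_atTop_atTop.eventually
      (eventually_mul_rpow_mul_log_le hc1 (K / (ε / 2) / Real.log 2)),
    hlogb.eventually_ge_atTop ((1 + ε / 2) * (4 / ε)), hlogb.eventually_ge_atTop (1 / c),
    hlogb.eventually_gt_atTop 0, eventually_gt_atTop 0] with n h1 h2 h3 h4 h5
  set L := Real.logb 2 n
  have hn : (0 : ℝ) < n := by exact_mod_cast h5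
  have hk : 0 < ⌊c * L⌋₊ := by
    rw [Nat.floor_pos]
    rwa [div_le_iff₀ hc0, mul_comm] at h3
  refine ⟨⌊c * L⌋₊, hk, ?_⟩
  have hk' : (0 : ℝ) < ⌊c * L⌋₊ := by exact_mod_cast hk
  have hk1 : c * L - 1 ≤ ⌊c * L⌋₊ := (Nat.sub_one_lt_floor _).le
  have hk2 : (⌊c * L⌋₊ : ℝ) ≤ c * L := Nat.floor_le (by positivity)
  have hA : (n : ℝ) / ⌊c * L⌋₊ ≤ (1 + ε / 2) * (n / L) := by
    rw [← mul_div_assoc, div_le_div_iff₀ hk' h4, mul_comm (1 + ε / 2), mul_assoc]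
    refine mul_le_mul_of_nonneg_left ?_ hn.le
    have e1 : (1 + ε / 2) * c = 1 + ε / 4 := by rw [hc]; field_simp
    have e2 : (1 + ε / 2) * (4 / ε) * (ε / 4) = 1 + ε / 2 := by field_simp
    nlinarith
  have hB : K * 2 ^ ⌊c * L⌋₊ ≤ ε / 2 * (n / L) := by
    have e1 : (2 : ℝ) ^ ⌊c * L⌋₊ ≤ (n : ℝ) ^ c := by
      rw [← Real.rpow_natCast]
      calc (2 : ℝ) ^ (⌊c * L⌋₊ : ℝ) ≤ 2 ^ (L * c) :=
            Real.rpow_le_rpow_of_exponent_le one_le_two (by rwa [mul_comm L])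
        _ = (n : ℝ) ^ c := by
            rw [Real.rpow_mul zero_le_two, Real.rpow_logb two_pos (by norm_num) hn]
    have e2 : Real.log n = L * Real.log 2 := by
      simp only [L, Real.logb]; field_simp
    rw [← mul_div_assoc, le_div_iff₀ h4]
    rw [e2] at h1
    calc K * 2 ^ ⌊c * L⌋₊ * L ≤ K * (n : ℝ) ^ c * L := by gcongr
      _ = ε / 2 * (K / (ε / 2) / Real.log 2 * (n : ℝ) ^ c * (L * Real.log 2)) := by field_simp
      _ ≤ ε / 2 * n := by gcongr
  linarith

/-- For `s` about `(1 + δ) m / ln m` the exponential is at most `m ^ (1 / (1 + δ))`, so `s`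
dominates. As `1 / ln 2 < 1.443` strictly, no `ε` is needed. -/
theorem exists_zeroSet_parameter (K : ℝ) (hK : 0 ≤ K) :
    ∀ᶠ m : ℕ in atTop, ∃ s : ℕ, 0 < s ∧ s + 1 ≤ m ∧
      s + 1 + K * Real.exp ((m : ℝ) / s) ≤ 1.443 * (m / Real.logb 2 m) := by
  -- Small enough for `1 + 2 δ ≤ 1.443 * ln 2`.
  set δ : ℝ := 0.0001 with hδ
  have hδ0 : 0 < δ := by norm_num [hδ]
  have hc1 : 1 / (1 + δ) < 1 := by rw [div_lt_one (by positivity)]; linarith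
  have hlog : Tendsto (fun n : ℕ => Real.log n) atTop atTop :=
    Real.tendsto_log_atTop.comp tendsto_natCast_atTop_atTop
  filter_upwards [tendsto_natCast_atTop_atTop.eventually
      (eventually_mul_rpow_mul_log_le hc1 ((K + 2) / δ)),
    hlog.eventually_ge_atTop 2, eventually_gt_atTop 0] with m h1 h2 h5
  set L := Real.log m
  have hL : 0 < L := by linarith
  have hm : (0 : ℝ) < m := by exact_mod_cast h5
  have hm1 : (1 : ℝ) ≤ m := by exact_mod_cast h5
  set s := ⌈(1 + δ) * m / L⌉₊
  have hs : 0 < s := Nat.ceil_pos.2 (by positivity)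
  have hs0 : (0 : ℝ) < s := by exact_mod_cast hs
  have hs1 : (1 + δ) * m / L ≤ s := Nat.le_ceil _
  have hs2 : (s : ℝ) ≤ (1 + δ) * m / L + 1 := (Nat.ceil_lt_add_one (by positivity)).le
  have hexp : Real.exp ((m : ℝ) / s) ≤ (m : ℝ) ^ (1 / (1 + δ)) := by
    rw [Real.rpow_def_of_pos hm, Real.exp_le_exp, div_le_iff₀ hs0]
    calc (m : ℝ) = L * (1 / (1 + δ)) * ((1 + δ) * m / L) := by field_simp
      _ ≤ _ := by gcongr
  have hone : 1 ≤ (m : ℝ) ^ (1 / (1 + δ)) := Real.one_le_rpow hm1 (by positivity)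
  -- The 2 pays for rounding `s` up and for the summand 1.
  have hsmall : (K + 2) * (m : ℝ) ^ (1 / (1 + δ)) ≤ δ * (m / L) := by
    rw [← mul_div_assoc, le_div_iff₀ hL]
    calc _ = δ * ((K + 2) / δ * (m : ℝ) ^ (1 / (1 + δ)) * L) := by field_simp
      _ ≤ _ := by gcongr
  have hmain : s + 1 + K * Real.exp ((m : ℝ) / s) ≤ (1 + 2 * δ) * (m / L) := by
    have : K * Real.exp ((m : ℝ) / s) ≤ K * (m : ℝ) ^ (1 / (1 + δ)) := by gcongr
    rw [mul_div_assoc] at hs2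
    linarith
  refine ⟨s, hs, ?_, hmain.trans ?_⟩
  · have hKe : 0 ≤ K * Real.exp ((m : ℝ) / s) := by positivity
    have : (1 + 2 * δ) * (m / L) ≤ m := by
      rw [← mul_div_assoc, div_le_iff₀ hL, mul_comm]
      exact mul_le_mul_of_nonneg_left (by norm_num [hδ]; linarith) hm.le
    have : (s : ℝ) + 1 ≤ m := by linarith
    exact_mod_cast this
  · have e1 : (m : ℝ) / Real.logb 2 m = Real.log 2 * (m / L) := by
      simp only [Real.logb, L]; field_simp
    rw [e1, ← mul_assoc]
    have := Real.log_two_gt_d9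
    gcongr
    rw [hδ]
    linarith

theorem natCast_div_logb_le {n m : ℕ} (hn : 3 ≤ n) (hnm : n ≤ m) :
    (n : ℝ) / Real.logb 2 n ≤ m / Real.logb 2 m := by
  have h3 : Real.exp 1 ≤ n := by
    have : (3 : ℝ) ≤ n := by exact_mod_cast hn
    linarith [Real.exp_one_lt_d9]
  have hnm' : (n : ℝ) ≤ m := by exact_mod_cast hnm
  have hn1 : (1 : ℝ) < n := by exact_mod_cast (by omega : 1 < n)
  have h := Real.log_div_self_antitoneOn (Set.mem_Ici.2 h3) (Set.mem_Ici.2 (h3.trans hnm')) hnm'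
  have hpos : 0 < Real.log m := Real.log_pos (hn1.trans_le hnm')
  have h' := inv_anti₀ (by have : (0:ℝ) < m := by linarith
                           positivity) h
  rw [inv_div, inv_div] at h'
  simp only [Real.logb, div_div_eq_mul_div, mul_div_right_comm]
  gcongr

end Asymptotics

/-! ### Asymptotic bounds for hypergraphs -/

theorem exists_forall_informationRatio_le (t : ℕ) (ε : ℝ) (hε : 0 < ε) :
    ∃ N : ℕ, ∀ n : ℕ, N ≤ n →
      ∀ (V : Type u) [Fintype V] (H : Hypergraph V), Fintype.card V = n →
        H.IsUniformOn (t + 2) → informationRatio H.accessStructure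
          ≤ ENNReal.ofReal ((1 / ((t + 2)! : ℝ) + ε) * ((n : ℝ) ^ (t + 1) / Real.logb 2 n)) := by
  obtain ⟨N, hN⟩ := Filter.eventually_atTop.1
    (exists_chunk_size (3 * t + 4) ε (by positivity) hε)
  refine ⟨max N 2, fun n hn V _ H hV hH => ?_⟩
  obtain ⟨k, hk, hle⟩ := hN n ((le_max_left _ _).trans hn)
  have hn2 : 2 ≤ n := (le_max_right _ _).trans hn
  refine (informationRatio_le_of_chunk_size hH.2 (by omega) hk).trans
    (ENNReal.ofReal_le_ofReal ?_)
  rw [hV]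
  have hlog : 0 < Real.logb 2 n := Real.logb_pos one_lt_two (by exact_mod_cast hn2)
  have hfac : (1 : ℝ) ≤ (t + 2)! := by exact_mod_cast Nat.one_le_of_lt (Nat.factorial_pos _)
  calc _ ≤ (n : ℝ) ^ t / (t + 2)! * ((1 + ε) * (n / Real.logb 2 n)) := by gcongr
    _ = (1 / ((t + 2)! : ℝ) + ε / (t + 2)!) * ((n : ℝ) ^ (t + 1) / Real.logb 2 n) := by
        field_simp; ring
    _ ≤ _ := by
        gcongr
        exact div_le_self hε.le hfac

theorem exists_forall_informationRatio_le_of_dense (t : ℕ) :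
    ∃ N : ℕ, ∀ n m : ℕ, N ≤ n → N ≤ m →
      ∀ (V : Type u) [Fintype V] (H : Hypergraph V), Fintype.card V = n → H.IsUniformOn (t + 2) →
        (∀ T : Set V, T.ncard = t + 1 → (∃ e ∈ H.edgeSet, T ⊆ e) →
          (n : ℤ) - (m : ℤ) ≤ (H.setDegree T : ℤ)) →
        informationRatio H.accessStructure
          ≤ ENNReal.ofReal
              (1.443 / ((t + 2)! : ℝ) * ((n : ℝ) ^ t * (m : ℝ) / Real.logb 2 m)) := by
  obtain ⟨N, hN⟩ := Filter.eventually_atTop.1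
    (exists_zeroSet_parameter (t + 1) (by positivity))
  have key : ∀ n m : ℕ, N ≤ m → m ≤ n →
      ∀ (V : Type u) [Fintype V] (H : Hypergraph V), Fintype.card V = n → H.IsUniformOn (t + 2) →
        (∀ T : Set V, T.ncard = t + 1 → (∃ e ∈ H.edgeSet, T ⊆ e) →
          (n : ℤ) - (m : ℤ) ≤ (H.setDegree T : ℤ)) →
        informationRatio H.accessStructure
          ≤ ENNReal.ofReal
              (1.443 / ((t + 2)! : ℝ) * ((n : ℝ) ^ t * ((m : ℝ) / Real.logb 2 m))) := by
    rintro n m hm hmn V _ H rfl hH hdeg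
    obtain ⟨s, hs, hsm, hle⟩ := hN m hm
    refine (informationRatio_le_of_nonneighbors hH.2 (card_nonneighbors_linkGraph_le hdeg hH.2) hs
      (hsm.trans hmn)).trans (ENNReal.ofReal_le_ofReal ?_)
    calc _ ≤ (Fintype.card V : ℝ) ^ t / (t + 2)! * (1.443 * (m / Real.logb 2 m)) := by gcongr
      _ = _ := by ring
  refine ⟨max N 3, fun n m hn hm V _ H hV hH hdeg => ?_⟩
  rw [mul_div_assoc]
  rcases le_total m n with hmn | hnm
  · exact key n m ((le_max_left _ _).trans hm) hmn V H hV hH hdeg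
  -- For `n ≤ m` the degree condition with `n` in place of `m` is void, and `x / log x` increases
  -- from `e` on.
  · refine (key n n ((le_max_left _ _).trans hn) le_rfl V H hV hH fun T _ _ => by simp).trans
      (ENNReal.ofReal_le_ofReal ?_)
    gcongr ?_ * (?_ * ?_)
    exact natCast_div_logb_le ((le_max_right _ _).trans hn) hnm

/-! ### Graphs as 2-uniform hypergraphs -/

namespace SimpleGraph

variable {V : Type u} (G : SimpleGraph V)

/-- A graph as a `2`-uniform hypergraph. -/
def edgeHypergraph : Hypergraph V where
  vertexSet := Set.univ
  edgeSet := {e | ∃ v w, G.Adj v w ∧ e = {v, w}}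
  subset_vertexSet_of_mem_edgeSet' _ _ := Set.subset_univ _

theorem isUniformOn_edgeHypergraph : G.edgeHypergraph.IsUniformOn 2 := by
  refine ⟨rfl, ?_⟩
  rintro _ ⟨v, w, h, rfl⟩
  exact Set.ncard_pair h.ne

theorem accessStructure_edgeHypergraph :
    G.edgeHypergraph.accessStructure = G.accessStructure := by
  ext A
  constructor
  · rintro ⟨_, ⟨v, w, h, rfl⟩, hA⟩
    exact ⟨v, hA (by simp), w, hA (by simp), h⟩
  · rintro ⟨v, hv, w, hw, h⟩
    exact ⟨_, ⟨v, w, h, rfl⟩, Set.insert_subset hv (Set.singleton_subset_iff.2 hw)⟩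

theorem degree_le_setDegree_edgeHypergraph [Fintype V] [DecidableRel G.Adj] (v : V) :
    G.degree v ≤ G.edgeHypergraph.setDegree {v} := by
  have hinj : Set.InjOn (fun w => ({v, w} : Set V)) (G.neighborFinset v : Set V) := by
    intro w hw w' hw' h
    simp only [Finset.mem_coe, mem_neighborFinset] at hw hw'
    have hmem : w ∈ ({v, w'} : Set V) := by
      rw [← show ({v, w} : Set V) = {v, w'} from h]; simp
    exact hmem.resolve_left hw.ne'
  rw [← card_neighborFinset_eq_degree, ← Set.ncard_coe_finset, ← hinj.ncard_image]
  refine Set.ncard_le_ncard ?_ (Set.toFinite _)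
  rintro _ ⟨w, hw, rfl⟩
  simp only [Finset.mem_coe, mem_neighborFinset] at hw
  exact ⟨⟨v, w, hw, rfl⟩, by simp⟩

end SimpleGraph
end

theorem corollary5 :
    -- arbitrary graphs
    (∀ ε : ℝ, 0 < ε → ∃ N : ℕ, ∀ n : ℕ, N ≤ n →
      ∀ (V : Type u) [Fintype V] (G : SimpleGraph V), Fintype.card V = n →
        informationRatio G.accessStructure
          ≤ ENNReal.ofReal ((1 / 2 + ε) * ((n : ℝ) / Real.logb 2 n)))
    ∧
    -- graphs in which every vertex has degree at least `n - m`
    (∀ ε : ℝ, 0 < ε → ∃ N : ℕ, ∀ n m : ℕ, N ≤ n → N ≤ m →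
      ∀ (V : Type u) [Fintype V] (G : SimpleGraph V) [DecidableRel G.Adj],
        Fintype.card V = n →
        (∀ v : V, (n : ℤ) - (m : ℤ) ≤ (G.degree v : ℤ)) →
        informationRatio G.accessStructure
          ≤ ENNReal.ofReal ((0.722 + ε) * ((m : ℝ) / Real.logb 2 m)))
    ∧
    -- arbitrary `d`-uniform hypergraphs
    (∀ d : ℕ, 2 ≤ d → ∀ ε : ℝ, 0 < ε → ∃ N : ℕ, ∀ n : ℕ, N ≤ n →
      ∀ (V : Type u) [Fintype V] (H : Hypergraph V), Fintype.card V = n → H.IsUniformOn d →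
        informationRatio H.accessStructure
          ≤ ENNReal.ofReal ((1 / (d ! : ℝ) + ε) * ((n : ℝ) ^ (d - 1) / Real.logb 2 n)))
    ∧
    -- dense `d`-uniform hypergraphs
    (∀ d : ℕ, 2 ≤ d → ∀ ε : ℝ, 0 < ε → ∃ N : ℕ, ∀ n m : ℕ, N ≤ n → N ≤ m →
      ∀ (V : Type u) [Fintype V] (H : Hypergraph V), Fintype.card V = n → H.IsUniformOn d →
        (∀ T : Set V, T.ncard = d - 1 → (∃ e ∈ H.edgeSet, T ⊆ e) →
          (n : ℤ) - (m : ℤ) ≤ (H.setDegree T : ℤ)) →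
        informationRatio H.accessStructure
          ≤ ENNReal.ofReal
              ((1.443 / (d ! : ℝ) + ε) * ((n : ℝ) ^ (d - 2) * (m : ℝ) / Real.logb 2 m))) := by
  refine ⟨fun ε hε => ?_, fun ε hε => ?_, fun d hd ε hε => ?_, fun d hd ε hε => ?_⟩
  · obtain ⟨N, hN⟩ := exists_forall_informationRatio_le.{u} 0 ε hε
    refine ⟨N, fun n hn V _ G hV => ?_⟩
    have h := hN n hn V G.edgeHypergraph hV G.isUniformOn_edgeHypergraph
    rw [G.accessStructure_edgeHypergraph] at h
    simpa using h
  · obtain ⟨N, hN⟩ := exists_forall_informationRatio_le_of_dense.{u} 0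
    refine ⟨max N 2, fun n m hn hm V _ G _ hV hdeg => ?_⟩
    have h := hN n m ((le_max_left _ _).trans hn) ((le_max_left _ _).trans hm) V
      G.edgeHypergraph hV G.isUniformOn_edgeHypergraph ?_
    · rw [G.accessStructure_edgeHypergraph] at h
      refine h.trans (ENNReal.ofReal_le_ofReal ?_)
      have hm2 : 2 ≤ m := (le_max_right _ _).trans hm
      have hlog : 0 < Real.logb 2 m := Real.logb_pos one_lt_two (by exact_mod_cast hm2)
      rw [pow_zero, one_mul]
      gcongr
      -- `1.443 / 2 = 0.7215` is below `0.722`.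
      norm_num
      linarith
    · intro T hT _
      obtain ⟨v, rfl⟩ := Set.ncard_eq_one.1 hT
      have := G.degree_le_setDegree_edgeHypergraph v
      have := hdeg v
      omega
  · obtain ⟨t, rfl⟩ := Nat.exists_eq_add_of_le' hd
    exact exists_forall_informationRatio_le t ε hε
  · obtain ⟨t, rfl⟩ := Nat.exists_eq_add_of_le' hd
    obtain ⟨N, hN⟩ := exists_forall_informationRatio_le_of_dense.{u} t
    refine ⟨max N 2, fun n m hn hm V _ H hV hH hdeg => ?_⟩
    refine (hN n m ((le_max_left _ _).trans hn) ((le_max_left _ _).trans hm) V H hV hH hdeg).trans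
      (ENNReal.ofReal_le_ofReal ?_)
    have hm2 : 2 ≤ m := (le_max_right _ _).trans hm
    have hlog : 0 < Real.logb 2 m := Real.logb_pos one_lt_two (by exact_mod_cast hm2)
    rw [Nat.add_sub_cancel]
    gcongr
    linarith
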